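/- A Tychonoff space $X$ is called Dieudonné complete if its topology is induced by some complete uniformity. The free locally convex space $L(X)$ is the real vector space with Hamel basis $X$, equipped with the finest locally convex vector space topology for which the inclusion $X\to L(X)$ is continuous. A locally convex space $E$ is called semi-reflexive if the canonical map $E\to E''$, $x\mapsto(\varphi\mapsto\varphi(x))$, is onto, where $E'$ carries the strong topology (uniform convergence on bounded subsets of $E$) and $E''$ is the topological dual of $E'$. Let $X$ be a Dieudonné complete Tychonoff space. Then $L(X)$ is semi-reflexive if and only if $X$ has no infinite compact subset. -/

import Mathlib

/-- A topological space is Dieudonné complete if its topology is induced by some complete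
uniformity. (It is used for Tychonoff spaces only; `T35Space` is assumed separately.) -/
def IsDieudonneComplete (X : Type*) [t : TopologicalSpace X] : Prop :=
  ∃ u : UniformSpace X, u.toTopologicalSpace = t ∧ @CompleteSpace X u

/-- A real locally convex space `E` is semi-reflexive if the canonical map `E → E''`,
`x ↦ (φ ↦ φ x)`, is onto. Here `StrongDual ℝ E` is the space of continuous linear functionals
with the strong topology (uniform convergence on the von Neumann bounded subsets of `E`), and
`E''` is the space of the functionals on it that are continuous for this topology. -/
def IsSemiReflexive (E : Type*) [AddCommGroup E] [Module ℝ E] [TopologicalSpace E] : Prop :=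
  ∀ Φ : StrongDual ℝ (StrongDual ℝ E), ∃ x : E, ∀ φ : StrongDual ℝ E, Φ φ = φ x

/-- The free (real) locally convex space on `X`: the real vector space with Hamel basis `X`,
with the finest locally convex vector space topology that makes `X → L(X)` continuous. -/
def FreeLCS (X : Type*) : Type _ := X →₀ ℝ

namespace FreeLCS

noncomputable instance instAddCommGroup (X : Type*) : AddCommGroup (FreeLCS X) :=
  inferInstanceAs (AddCommGroup (X →₀ ℝ))

noncomputable instance instModule (X : Type*) : Module ℝ (FreeLCS X) :=
  inferInstanceAs (Module ℝ (X →₀ ℝ))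

/-- The canonical map `X → L(X)` onto the Hamel basis. -/
noncomputable def of {X : Type*} (x : X) : FreeLCS X := (Finsupp.single x 1 : X →₀ ℝ)

/-- The locally convex vector space topologies on the free vector space for which the canonical
map `of` is continuous. -/
def lcTopologies (X : Type*) [TopologicalSpace X] : Set (TopologicalSpace (FreeLCS X)) :=
  {t | @IsTopologicalAddGroup (FreeLCS X) t _ ∧ @ContinuousSMul ℝ (FreeLCS X) _ _ t ∧
    @LocallyConvexSpace ℝ (FreeLCS X) _ _ _ _ t ∧ @Continuous X (FreeLCS X) _ t of}

-- In Mathlib's order on topologies `sInf` is the topology generated by the union of a family;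
-- it lies again in `lcTopologies X`, of which it is therefore the finest member.
instance instTopologicalSpace (X : Type*) [TopologicalSpace X] : TopologicalSpace (FreeLCS X) :=
  sInf (lcTopologies X)

instance instIsTopologicalAddGroup (X : Type*) [TopologicalSpace X] :
    IsTopologicalAddGroup (FreeLCS X) :=
  topologicalAddGroup_sInf fun _ h => h.1

instance instContinuousSMul (X : Type*) [TopologicalSpace X] : ContinuousSMul ℝ (FreeLCS X) :=
  continuousSMul_sInf fun _ h => h.2.1

instance instLocallyConvexSpace (X : Type*) [TopologicalSpace X] :
    LocallyConvexSpace ℝ (FreeLCS X) :=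
  LocallyConvexSpace.sInf fun _ h => h.2.2.1

theorem continuous_of {X : Type*} [TopologicalSpace X] : Continuous (of : X → FreeLCS X) :=
  continuous_sInf_rng.2 fun _ h => h.2.2.2

/-- The universal property of `L(X)`: a continuous map from `X` to a locally convex space extends
uniquely to a continuous linear map on `L(X)`. -/
theorem existsUnique_lift {X : Type*} [TopologicalSpace X] {E : Type*} [AddCommGroup E]
    [Module ℝ E] [TopologicalSpace E] [IsTopologicalAddGroup E] [ContinuousSMul ℝ E]
    [LocallyConvexSpace ℝ E] (f : X → E) (hf : Continuous f) :
    ∃! T : FreeLCS X →L[ℝ] E, ∀ x, T (of x) = f x := by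
  let T₀ : FreeLCS X →ₗ[ℝ] E := Finsupp.lift E ℝ X f
  have hT₀ : ∀ x, T₀ (of x) = f x := by
    intro x
    change Finsupp.lift E ℝ X f (Finsupp.single x 1) = f x
    simp
  have hc : Continuous T₀ := by
    rw [continuous_iff_le_induced]
    refine sInf_le ⟨topologicalAddGroup_induced T₀, continuousSMul_induced T₀,
      LocallyConvexSpace.induced T₀, ?_⟩
    rw [continuous_induced_rng]
    convert hf using 1
    exact funext hT₀
  refine ⟨⟨T₀, hc⟩, hT₀, fun S hS => ?_⟩
  have h : (S : FreeLCS X →ₗ[ℝ] E) = T₀ := by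
    refine Finsupp.lhom_ext' (M := ℝ) (α := X) fun x => LinearMap.ext_ring ?_
    exact (hS x).trans (hT₀ x).symm
  ext v
  exact LinearMap.congr_fun h v

/-- For a Tychonoff space `X` the space `L(X)` is Hausdorff. -/
instance instT2Space {X : Type*} [TopologicalSpace X] [T35Space X] : T2Space (FreeLCS X) := by
  refine ⟨fun v w hvw => ?_⟩
  let z : X →₀ ℝ := v - w
  have hz : z ≠ 0 := sub_ne_zero.2 hvw
  obtain ⟨a, ha⟩ := Finsupp.ne_iff.1 hz
  obtain ⟨f, hf, hfa, hf1⟩ := CompletelyRegularSpace.completely_regular a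
    ((z.support : Set X) \ {a}) (z.support.finite_toSet.sdiff.isClosed) (by simp)
  have hg : Continuous fun x => 1 - (f x : ℝ) :=
    continuous_const.sub (continuous_subtype_val.comp hf)
  obtain ⟨T, hT, -⟩ := existsUnique_lift (fun x => 1 - (f x : ℝ)) hg
  have hTz : T v - T w = z a := by
    rw [← map_sub]
    have h : (T : FreeLCS X →ₗ[ℝ] ℝ) = Finsupp.lift ℝ ℝ X fun x => 1 - (f x : ℝ) := by
      refine Finsupp.lhom_ext' (M := ℝ) (α := X) fun x => LinearMap.ext_ring ?_
      refine (hT x).trans ?_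
      simp
    have h' : T (v - w) = Finsupp.lift ℝ ℝ X (fun x => 1 - (f x : ℝ)) z :=
      LinearMap.congr_fun h (v - w)
    rw [h', Finsupp.lift_apply, Finsupp.sum, Finset.sum_eq_single a]
    · simp [hfa]
    · intro b hb hba
      have : f b = 1 := hf1 ⟨hb, hba⟩
      simp [this]
    · intro h0
      simp [Finsupp.notMem_support_iff.1 h0]
  refine separated_by_continuous T.continuous fun h => ha ?_
  rw [← hTz, h, sub_self]
  rfl

end FreeLCS

open Filter Topology Bornology

/-! If `K` is compact and infinite, distinct points `xₙ ∈ K` give a functional `φ ↦ ∑ 2⁻ⁿ φ(xₙ)` on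
the strong dual. An element of `L(X)` has finite support, so it cannot represent this functional.
Conversely, the key lemma `totallyBounded_supp` says that the points occurring in a bounded set `B ⊆
L(X)` form a totally bounded set. By completeness its closure is compact, hence finite if all
compact sets are. A functional on the strong dual is controlled by some such `B`, so it is a
combination of finitely many point evaluations, that is, an element of `L(X)`. -/

/-- The solution of the triangular system `∑ k ≤ n, c k * a k n = n` by forward substitution. -/
noncomputable def triangularSolution (a : ℕ → ℕ → ℝ) : ℕ → ℝ
  | n => (n - ∑ k : Fin n, triangularSolution a k * a k n) / a n n

theorem exists_triangular_solution (a : ℕ → ℕ → ℝ) (ha : ∀ n, a n n ≠ 0) :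
    ∃ c : ℕ → ℝ, ∀ n, ∑ k ∈ Finset.range (n + 1), c k * a k n = n := by
  refine ⟨triangularSolution a, fun n => ?_⟩
  rw [Finset.sum_range_succ, triangularSolution, div_mul_cancel₀ _ (ha n), ← Fin.sum_univ_eq_sum_range
    (fun k => triangularSolution a k * a k n)]
  ring

/-- A function on `X` taking prescribed integrals against a sequence of finitely supported measures
which is triangular with respect to a locally finite family of continuous functions. -/
theorem exists_continuous_sum_eq_natCast {X : Type*} [TopologicalSpace X] (b : ℕ → X →₀ ℝ)
    (h : ℕ → X → ℝ) (hc : ∀ k, Continuous (h k))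
    (hf : LocallyFinite fun k => Function.support (h k))
    (h0 : ∀ n k, n < k → ∀ y ∈ (b n).support, h k y = 0)
    (hd : ∀ n, ∑ y ∈ (b n).support, b n y * h n y ≠ 0) :
    ∃ g : X → ℝ, Continuous g ∧ ∀ n, ∑ y ∈ (b n).support, b n y * g y = n := by
  obtain ⟨c, hcn⟩ := exists_triangular_solution
    (fun k n => ∑ y ∈ (b n).support, b n y * h k y) hd
  refine ⟨fun x => ∑ᶠ k, c k * h k x, ?_, fun n => ?_⟩
  · refine continuous_finsum (fun k => continuous_const.mul (hc k)) (hf.subset fun k x hx => ?_)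
    exact right_ne_zero_of_mul hx
  · rw [← hcn n]
    simp_rw [Finset.mul_sum]
    rw [Finset.sum_comm]
    refine Finset.sum_congr rfl fun y hy => ?_
    rw [finsum_eq_sum_of_support_subset (s := Finset.range (n + 1)), Finset.mul_sum]
    · exact Finset.sum_congr rfl fun k _ => by ring
    · intro k hk
      by_contra hkn
      simp only [Finset.coe_range, Set.mem_Iio, not_lt] at hkn
      exact hk (by simp [h0 n k hkn y hy])

theorem exists_continuous_bump {X : Type*} [TopologicalSpace X] [CompletelyRegularSpace X] (x : X)
    (K : Set X) (hK : IsClosed K) (hx : x ∉ K) :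
    ∃ f : X → ℝ, Continuous f ∧ f x = 1 ∧ (∀ y ∈ K, f y = 0) ∧ ∀ y, 0 ≤ f y := by
  obtain ⟨f, hf, hfx, hfK⟩ := CompletelyRegularSpace.completely_regular x K hK hx
  refine ⟨fun y => 1 - (f y : ℝ), continuous_const.sub (continuous_subtype_val.comp hf), by simp [hfx],
    fun y hy => ?_, fun y => sub_nonneg.2 (f y).2.2⟩
  have : f y = 1 := hfK hy
  simp [this]

namespace FreeLCS

/-- The coordinates of an element of `L(X)` with respect to the Hamel basis `X`. -/
def coords {X : Type*} (v : FreeLCS X) : X →₀ ℝ := v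

theorem eq_sum_of {X : Type*} (v : FreeLCS X) :
    v = ∑ x ∈ v.coords.support, v.coords x • of x := by
  refine (Finsupp.sum_single v.coords).symm.trans ?_
  refine Finset.sum_congr rfl fun x _ => ?_
  exact (Finsupp.smul_single_one x (v.coords x)).symm

theorem apply_eq_sum {X : Type*} [TopologicalSpace X]
    (φ : StrongDual ℝ (FreeLCS X)) (v : FreeLCS X) :
    φ v = ∑ x ∈ v.coords.support, v.coords x * φ (of x) := by
  conv_lhs => rw [eq_sum_of v]
  simp

/-- The support of a set of elements of `L(X)`. -/
def supp {X : Type*} (B : Set (FreeLCS X)) : Set X := {x | ∃ b ∈ B, x ∈ b.coords.support}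

/-- Otherwise uniformly separated points of the support carry a locally finite family of bumps, from
which one builds a continuous function whose linear extension is unbounded on `B`. -/
theorem totallyBounded_supp {X : Type*} [UniformSpace X] [T35Space X] {B : Set (FreeLCS X)}
    (hB : IsVonNBounded ℝ B) : TotallyBounded (supp B) := by
  by_contra hS
  simp only [TotallyBounded, not_forall, not_exists, not_and] at hS
  obtain ⟨U, hU, hS⟩ := hS
  obtain ⟨W, hW, hWs, hWU⟩ := comp_symm_mem_uniformity_sets hU
  obtain ⟨V, hV, hVo, hVs, hVW⟩ := comp_open_symm_mem_uniformity_sets hW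
  have hsub : ∀ {x y}, (x, y) ∈ V → (x, y) ∈ W := fun {x y} h => hVW ⟨x, refl_mem_uniformity hV, h⟩
  have hsubU : ∀ {x y}, (x, y) ∈ W → (x, y) ∈ U := fun {x y} h => hWU ⟨x, refl_mem_uniformity hW, h⟩
  -- Pairs `(bₙ, xₙ)` with `xₙ` in the support of `bₙ` and `U`-far from the supports of all earlier
  -- `bₘ`, not only from the earlier `xₘ`: this makes the system triangular.
  obtain ⟨p, hp, hpr⟩ := exists_seq_of_forall_finset_exists
    (fun p : FreeLCS X × X => p.1 ∈ B ∧ p.2 ∈ p.1.coords.support)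
    (fun p q => ∀ y ∈ p.1.coords.support, (q.2, y) ∉ U) (by
      intro s _
      have hfin : (⋃ p ∈ s, (p.1.coords.support : Set X)).Finite :=
        s.finite_toSet.biUnion fun p _ => p.1.coords.support.finite_toSet
      obtain ⟨x, ⟨b, hb, hx⟩, hxU⟩ := Set.not_subset.1 (hS _ hfin)
      refine ⟨(b, x), ⟨hb, hx⟩, fun p hps y hy hxy => hxU ?_⟩
      exact Set.mem_biUnion (Set.mem_biUnion hps hy) hxy)
  -- Vanishing on the rest of the support of `bₙ` leaves the diagonal entry `bₙ(xₙ) ≠ 0`.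
  have hbump : ∀ n, ∃ f : X → ℝ, Continuous f ∧ f (p n).2 = 1 ∧
      (∀ y ∈ {y | ((p n).2, y) ∉ V} ∪ (((p n).1.coords.support : Set X) \ {(p n).2}), f y = 0) ∧
      ∀ y, 0 ≤ f y := by
    intro n
    refine exists_continuous_bump _ _ (IsClosed.union ?_ ?_) ?_
    · exact (hVo.preimage (Continuous.prodMk_right (p n).2)).isClosed_compl
    · exact ((p n).1.coords.support.finite_toSet.sdiff).isClosed
    · simp [refl_mem_uniformity hV]
  choose h hc h1 hz _ using hbump
  have hsupp : ∀ n y, h n y ≠ 0 → ((p n).2, y) ∈ V := fun n y hy => by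
    by_contra hyV
    exact hy (hz n y (Or.inl hyV))
  obtain ⟨g, hg, hgn⟩ := exists_continuous_sum_eq_natCast (fun n => (p n).1.coords) h hc
    (by
      intro z
      -- A `V`-ball meeting two bumps would make their centres `U`-close, so it meets at most one.
      refine ⟨UniformSpace.ball z V, UniformSpace.ball_mem_nhds z hV, Set.Subsingleton.finite ?_⟩
      have key : ∀ m n y y', h m y ≠ 0 → (z, y) ∈ V → h n y' ≠ 0 → (z, y') ∈ V →
          ((p n).2, (p m).2) ∈ U := fun m n y y' hm hy hn hy' =>
        hWU ⟨z, hVW ⟨y', hsupp n y' hn, hVs.symm _ _ hy'⟩, hVW ⟨y, hy, hVs.symm _ _ (hsupp m y hm)⟩⟩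
      rintro m ⟨y, hm, hy⟩ n ⟨y', hn, hy'⟩
      by_contra hmn
      rcases lt_or_gt_of_ne hmn with hlt | hlt
      · exact hpr m n hlt _ (hp m).2 (key m n y y' hm hy hn hy')
      · exact hpr n m hlt _ (hp n).2 (key n m y' y hn hy' hm hy))
    (by
      intro n k hnk y hy
      by_contra hne
      exact hpr n k hnk y hy (hsubU (hsub (hsupp k y hne))))
    (by
      intro n
      rw [Finset.sum_eq_single (p n).2]
      · simpa [h1] using (hp n).2
      · intro y hy hne
        rw [hz n y (Or.inr ⟨hy, hne⟩), mul_zero]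
      · exact fun hn => absurd (hp n).2 hn)
  -- `T bₙ = n` for all `n`, although `T` maps `B` to a bounded set.
  obtain ⟨T, hT, -⟩ := existsUnique_lift g hg
  have hbd := (NormedSpace.isVonNBounded_iff ℝ).1 (hB.image T)
  obtain ⟨C, hC⟩ := hbd.exists_norm_le
  obtain ⟨n, hn⟩ := exists_nat_gt C
  have := hC _ (Set.mem_image_of_mem T (hp n).1)
  rw [apply_eq_sum] at this
  simp_rw [hT] at this
  rw [hgn] at this
  simp at this
  linarith

theorem finite_supp {X : Type*} [UniformSpace X] [CompleteSpace X]
    [T35Space X] (hX : ∀ K : Set X, IsCompact K → K.Finite) {B : Set (FreeLCS X)} (hB : IsVonNBounded ℝ B) :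
    (supp B).Finite :=
  (hX _ ((totallyBounded_supp hB).closure.isCompact_of_isClosed isClosed_closure)).subset
    subset_closure

/-- A functional on the strong dual is dominated by the restriction to some bounded set. -/
theorem exists_isVonNBounded_forall_eq_zero {E : Type*} [AddCommGroup E] [Module ℝ E]
    [TopologicalSpace E] (Φ : StrongDual ℝ (StrongDual ℝ E)) :
    ∃ B : Set E, IsVonNBounded ℝ B ∧ ∀ φ : StrongDual ℝ E, (∀ b ∈ B, φ b = 0) → Φ φ = 0 := by
  have hnhds : Φ ⁻¹' Metric.ball 0 1 ∈ 𝓝 (0 : StrongDual ℝ E) :=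
    Φ.continuous.continuousAt.preimage_mem_nhds (by simpa using Metric.ball_mem_nhds (0 : ℝ) one_pos)
  obtain ⟨⟨B, N⟩, ⟨hB, hN⟩, hBN⟩ := ContinuousLinearMap.hasBasis_nhds_zero.mem_iff.1 hnhds
  refine ⟨B, hB, fun φ hφ => ?_⟩
  by_contra hne
  -- The rescaled functional still vanishes on `B`, but `Φ` takes the value 1 on it.
  have hmem : (Φ φ)⁻¹ • φ ∈ {f : StrongDual ℝ E | ∀ x ∈ B, f x ∈ N} := fun x hx => by
    simpa [hφ x hx] using mem_of_mem_nhds hN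
  have := hBN hmem
  simp [hne] at this

theorem isSemiReflexive_of_forall_isCompact_finite {X : Type*} [UniformSpace X] [CompleteSpace X]
    [T35Space X] (hX : ∀ K : Set X, IsCompact K → K.Finite) : IsSemiReflexive (FreeLCS X) := by
  intro Φ
  obtain ⟨B, hB, hΦ⟩ := exists_isVonNBounded_forall_eq_zero Φ
  have hfin := finite_supp hX hB
  have : Finite (supp B) := hfin
  let ev : FreeLCS X →ₗ[ℝ] StrongDual ℝ (FreeLCS X) →ₗ[ℝ] ℝ :=
    (ContinuousLinearMap.coeLM ℝ : StrongDual ℝ (FreeLCS X) →ₗ[ℝ] FreeLCS X →ₗ[ℝ] ℝ).flip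
  have hmem : (Φ : StrongDual ℝ (FreeLCS X) →ₗ[ℝ] ℝ) ∈
      Submodule.span ℝ (Set.range fun x : supp B => ev (of x.1)) := by
    -- A functional that vanishes on the common kernel of finitely many others is in their span.
    refine mem_span_of_iInf_ker_le_ker fun φ hφ => ?_
    simp only [Submodule.mem_iInf, LinearMap.mem_ker] at hφ
    refine hΦ φ fun b hb => ?_
    rw [apply_eq_sum]
    refine Finset.sum_eq_zero fun x hx => ?_
    rw [show φ (of x) = 0 from hφ ⟨x, b, hb, hx⟩, mul_zero]
  have hle : Submodule.span ℝ (Set.range fun x : supp B => ev (of x.1)) ≤ LinearMap.range ev :=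
    Submodule.span_le.2 (Set.range_subset_iff.2 fun x => ⟨_, rfl⟩)
  obtain ⟨v, hv⟩ := hle hmem
  exact ⟨v, fun φ => (LinearMap.congr_fun hv φ).symm⟩

/-- The functional `φ ↦ ∑ 2⁻ⁿ φ(xₙ)` attached to a sequence in a compact set is continuous on the
strong dual of `L(X)`. -/
theorem exists_strongDual_hasSum {X : Type*} [TopologicalSpace X] {K : Set X} (hK : IsCompact K)
    (x : ℕ → X) (hx : ∀ n, x n ∈ K) :
    ∃ Φ : StrongDual ℝ (StrongDual ℝ (FreeLCS X)),
      ∀ φ, HasSum (fun n => (1 / 2 : ℝ) ^ n * φ (of (x n))) (Φ φ) := by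
  have hgeo : Summable fun n : ℕ => (1 / 2 : ℝ) ^ n := summable_geometric_two
  have hterm : ∀ (φ : StrongDual ℝ (FreeLCS X)) (C : ℝ), (∀ y ∈ K, ‖φ (of y)‖ ≤ C) → ∀ n,
      ‖(1 / 2 : ℝ) ^ n * φ (of (x n))‖ ≤ (1 / 2 : ℝ) ^ n * C := fun φ C hC n => by
    rw [norm_mul, norm_pow, Real.norm_of_nonneg (by norm_num : (0 : ℝ) ≤ 1 / 2)]
    exact mul_le_mul_of_nonneg_left (hC _ (hx n)) (by positivity)
  have hsum : ∀ φ : StrongDual ℝ (FreeLCS X),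
      Summable fun n => (1 / 2 : ℝ) ^ n * φ (of (x n)) := fun φ => by
    obtain ⟨C, hC⟩ := hK.exists_bound_of_continuousOn (φ.continuous.comp continuous_of).continuousOn
    exact Summable.of_norm_bounded (hgeo.mul_right C) (hterm φ C hC)
  let Φ₀ : StrongDual ℝ (FreeLCS X) →ₗ[ℝ] ℝ :=
    { toFun := fun φ => ∑' n, (1 / 2 : ℝ) ^ n * φ (of (x n))
      map_add' := fun φ ψ => by
        rw [← (hsum φ).tsum_add (hsum ψ)]
        simp [mul_add]
      map_smul' := fun r φ => by
        rw [RingHom.id_apply, smul_eq_mul, ← tsum_mul_left]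
        simp [mul_left_comm] }
  have hcont : Continuous Φ₀ := by
    refine continuous_of_continuousAt_zero Φ₀ ?_
    rw [ContinuousAt, map_zero, Metric.tendsto_nhds]
    intro ε hε
    -- Since `∑ 2⁻ⁿ = 2`, the radius `ε / 4` bounds the sum by `ε / 2 < ε`.
    refine ContinuousLinearMap.hasBasis_nhds_zero.mem_iff.2
      ⟨(of '' K, Metric.closedBall 0 (ε / 4)),
        ⟨(hK.image continuous_of).isVonNBounded ℝ, Metric.closedBall_mem_nhds _ (by positivity)⟩,
        fun φ hφ => ?_⟩
    have hC : ∀ y ∈ K, ‖φ (of y)‖ ≤ ε / 4 := fun y hy => by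
      simpa using hφ _ (Set.mem_image_of_mem of hy)
    have hle := tsum_of_norm_bounded (hasSum_geometric_two.mul_right (ε / 4)) (hterm φ _ hC)
    rw [Set.mem_ofPred_eq, dist_zero_right]
    exact hle.trans_lt (by linarith)
  exact ⟨⟨Φ₀, hcont⟩, fun φ => (hsum φ).hasSum⟩

theorem not_isSemiReflexive_of_infinite_isCompact {X : Type*} [TopologicalSpace X] [T35Space X]
    {K : Set X} (hK : IsCompact K)
    (hinf : K.Infinite) : ¬ IsSemiReflexive (FreeLCS X) := by
  intro hR
  let x := hinf.natEmbedding
  obtain ⟨Φ, hΦ⟩ := exists_strongDual_hasSum hK (fun n => (x n : X)) fun n => (x n).2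
  obtain ⟨v, hv⟩ := hR Φ
  have hxinj : Function.Injective fun n => (x n : X) := Subtype.val_injective.comp x.injective
  obtain ⟨n, hn⟩ : ∃ n, (x n : X) ∉ v.coords.support := by
    by_contra! hall
    exact (Set.infinite_range_of_injective hxinj)
      (v.coords.support.finite_toSet.subset (Set.range_subset_iff.2 hall))
  -- As `f ≥ 0`, no cancellation occurs: `Φ T ≥ 2⁻ⁿ`, whereas `T v = 0`.
  obtain ⟨f, hf, hfx, hfz, hf0⟩ := exists_continuous_bump (x n : X) (v.coords.support : Set X)
    v.coords.support.finite_toSet.isClosed hn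
  obtain ⟨T, hT, -⟩ := existsUnique_lift f hf
  have hzero : Φ T = 0 := by
    rw [hv, apply_eq_sum]
    exact Finset.sum_eq_zero fun y hy => by rw [hT, hfz y hy, mul_zero]
  have hle := le_hasSum (hΦ T) n fun m _ => by
    rw [hT]
    exact mul_nonneg (by positivity) (hf0 _)
  rw [hzero, hT, hfx, mul_one] at hle
  exact absurd hle (not_le.2 (by positivity))

end FreeLCS

theorem theoremt {X : Type*} [TopologicalSpace X] [T35Space X] (hX : IsDieudonneComplete X) :
    IsSemiReflexive (FreeLCS X) ↔ ¬ ∃ K : Set X, IsCompact K ∧ K.Infinite := by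
  constructor
  · rintro hR ⟨K, hK, hinf⟩
    exact FreeLCS.not_isSemiReflexive_of_infinite_isCompact hK hinf hR
  · intro h
    obtain ⟨u, rfl, hc⟩ := hX
    exact FreeLCS.isSemiReflexive_of_forall_isCompact_finite fun K hK =>
      not_not.1 fun hinf => h ⟨K, hK, hinf⟩
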